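/- Let $\Pi_\sigma=\{s\in\mathbb{C}:\operatorname{Re}s>\sigma\}$, $\Pi=\Pi_0$, and let $U_1$ be the open unit disk. For a set $G\subset\mathbb{C}$, let $A(G)$ be the set of real numbers $\sigma'\ge 0$ with the following property: for every bounded holomorphic function $f$ on $\Pi$ with $f(\Pi)\subset G$ that is the sum of a Dirichlet series $f(s)=\sum_{n=1}^{\infty}a_n n^{-s}$ convergent at every point of $\Pi$, each partial sum $P_k(s)=\sum_{n=1}^{k}a_n n^{-s}$, $k\ge 1$, satisfies $P_k(\Pi_{\sigma'})\subset G$. The Rogosinski abscissa of $G$ is $\mathbf{r}(G)=\inf A(G)$. Theorem. Let $G$ be a bounded convex domain (nonempty, open) in $\mathbb{C}$. Then $A(G)$ and $A(U_1)$ are nonempty, so that $\mathbf{r}(G)$ and $\mathbf{r}(U_1)$ are finite, and $$\mathbf{r}(G)=\mathbf{r}(U_1).$$ -/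

import Mathlib

open Filter Topology

noncomputable section

namespace Rogosinski

/-- The open half-plane of all `s` with `Re s > σ`; the right half-plane is `halfPlane 0`. -/
def halfPlane (σ : ℝ) : Set ℂ := {s : ℂ | σ < s.re}

/-- The `k`-th partial sum `a₁ / 1 ^ s + ⋯ + a_k / k ^ s` of an ordinary Dirichlet series.
The value `a 0` is never used. -/
def partialSum (a : ℕ → ℂ) (k : ℕ) (s : ℂ) : ℂ :=
  ∑ n ∈ Finset.Icc 1 k, a n / (n : ℂ) ^ s

/-- `f` belongs to `H^∞` of the right half-plane: it is holomorphic and bounded there. -/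
def IsHInfty (f : ℂ → ℂ) : Prop :=
  DifferentiableOn ℂ f (halfPlane 0) ∧ ∃ M : ℝ, ∀ s ∈ halfPlane 0, ‖f s‖ ≤ M

/-- The Dirichlet series with coefficients `a` converges (possibly conditionally) to `f` at every
point of the right half-plane. -/
def IsDirichletSeriesOf (a : ℕ → ℂ) (f : ℂ → ℂ) : Prop :=
  ∀ s ∈ halfPlane 0, Tendsto (fun k : ℕ => partialSum a k s) atTop (𝓝 (f s))

/-- The real numbers `σ ≥ 0` such that, for every `f` in `H^∞` of the right half-plane which is
the sum of a Dirichlet series there and maps it into `G`, every partial sum of the series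
(with at least one term) maps `Re s > σ` into `G`. -/
def admissible (G : Set ℂ) : Set ℝ :=
  {σ : ℝ | 0 ≤ σ ∧ ∀ (f : ℂ → ℂ) (a : ℕ → ℂ), IsHInfty f → IsDirichletSeriesOf a f →
    Set.MapsTo f (halfPlane 0) G →
      ∀ k : ℕ, 1 ≤ k → Set.MapsTo (partialSum a k) (halfPlane σ) G}

/-- The Rogosinski abscissa of `G`: the infimum of the admissible numbers. The set
`admissible G` is bounded below by `0`, so this is the genuine infimum whenever
`admissible G` is nonempty. -/
def abscissa (G : Set ℂ) : ℝ := sInf (admissible G)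

end Rogosinski

end

open Filter Topology MeasureTheory

namespace Rogosinski

/-! ### Mean values of absolutely convergent trigonometric series -/

/-! For every bounded convex domain, `admissible G` equals `reAdmissible`, a set in which `G` does
not appear. If a partial sum takes a value `q` outside `G`, a line through `q` misses `G`. An affine
map sends the side containing `G` into `Re w > 0` and `q` to `0`, contradicting `re_partialSum_pos`.
Conversely, if `f` is bounded with `Re f ≥ 0`, then `f + ε` takes values in a huge disk tangent to
the imaginary axis at `0`. An affine map carries this disk onto a disk in `G` tangent to a
supporting line, and admissibility keeps the partial sums on the correct side of that line. Then `ε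
→ 0`. The sets are nonempty because the Carathéodory bound `norm_coeff_le` lets `Re a 1` dominate
the other terms far to the right. -/

theorem norm_exp_ofReal_mul_I_mul (l t : ℝ) : ‖Complex.exp (l * Complex.I * t)‖ = 1 := by
  rw [show (l : ℂ) * Complex.I * t = ((l * t : ℝ) : ℂ) * Complex.I by push_cast; ring]
  exact Complex.norm_exp_ofReal_mul_I _

theorem norm_mean_exp_le (l : ℝ) {T : ℝ} (hT : 0 < T) :
    ‖(T : ℂ)⁻¹ * ∫ t in (0 : ℝ)..T, Complex.exp (l * Complex.I * t)‖ ≤ 1 := by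
  have h := intervalIntegral.norm_integral_le_of_norm_le_const (a := (0 : ℝ)) (b := T)
    (f := fun t : ℝ => Complex.exp (l * Complex.I * t)) (C := 1)
    (fun t _ => (norm_exp_ofReal_mul_I_mul l t).le)
  rw [sub_zero, abs_of_pos hT, one_mul] at h
  rw [norm_mul, norm_inv, Complex.norm_real, Real.norm_of_nonneg hT.le]
  calc T⁻¹ * _ ≤ T⁻¹ * T := by gcongr
    _ = 1 := inv_mul_cancel₀ hT.ne'

theorem tendsto_mean_exp (l : ℝ) :
    Tendsto (fun T : ℝ => (T : ℂ)⁻¹ * ∫ t in (0 : ℝ)..T, Complex.exp (l * Complex.I * t)) atTop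
      (𝓝 (if l = 0 then 1 else 0)) := by
  split_ifs with hl
  · refine tendsto_const_nhds.congr' ?_
    filter_upwards [eventually_gt_atTop 0] with T hT
    have : (T : ℂ) ≠ 0 := by exact_mod_cast hT.ne'
    simp [hl, this]
  · have hc : (l : ℂ) * Complex.I ≠ 0 := by simp [hl]
    have h0 : Tendsto (fun T : ℝ => T⁻¹ * (2 / |l|)) atTop (𝓝 0) := by
      simpa using tendsto_inv_atTop_zero.mul_const (2 / |l|)
    refine squeeze_zero_norm' ?_ h0
    filter_upwards [eventually_gt_atTop 0] with T hT
    rw [integral_exp_mul_complex hc, norm_mul, norm_inv, Complex.norm_real,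
      Real.norm_of_nonneg hT.le, norm_div]
    have h1 : ‖(l : ℂ) * Complex.I‖ = |l| := by simp
    have h2 := norm_sub_le (Complex.exp (l * Complex.I * T))
      (Complex.exp (l * Complex.I * (0 : ℝ)))
    rw [norm_exp_ofReal_mul_I_mul, norm_exp_ofReal_mul_I_mul] at h2
    rw [h1]
    gcongr
    linarith

theorem summable_norm_mul_exp {b : ℕ → ℂ} (hb : Summable fun m => ‖b m‖) (l : ℕ → ℝ) (t : ℝ) :
    Summable fun m => ‖b m * Complex.exp (l m * Complex.I * t)‖ := by
  simpa [norm_mul, norm_exp_ofReal_mul_I_mul] using hb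

theorem continuous_trigSeries {b : ℕ → ℂ} (hb : Summable fun m => ‖b m‖) (l : ℕ → ℝ) :
    Continuous fun t : ℝ => ∑' m, b m * Complex.exp (l m * Complex.I * t) := by
  refine continuous_tsum (fun m => by fun_prop) hb fun m t => ?_
  rw [norm_mul, norm_exp_ofReal_mul_I_mul, mul_one]

/-- The mean value of an absolutely convergent trigonometric series is the sum of its
coefficients at frequency zero. -/
theorem tendsto_mean_trigSeries {b : ℕ → ℂ} (hb : Summable fun m => ‖b m‖) (l : ℕ → ℝ) :
    Tendsto (fun T : ℝ => (T : ℂ)⁻¹ *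
        ∫ t in (0 : ℝ)..T, ∑' m, b m * Complex.exp (l m * Complex.I * t)) atTop
      (𝓝 (∑' m, b m * if l m = 0 then 1 else 0)) := by
  have key : Tendsto (fun T : ℝ => ∑' m, b m * ((T : ℂ)⁻¹ *
      ∫ t in (0 : ℝ)..T, Complex.exp (l m * Complex.I * t))) atTop
      (𝓝 (∑' m, b m * if l m = 0 then 1 else 0)) := by
    refine tendsto_tsum_of_dominated_convergence hb
      (fun m => (tendsto_mean_exp (l m)).const_mul (b m)) ?_
    filter_upwards [eventually_gt_atTop 0] with T hT m
    rw [norm_mul]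
    exact mul_le_of_le_one_right (norm_nonneg _) (norm_mean_exp_le (l m) hT)
  refine key.congr fun T => ?_
  have hI : HasSum (fun m => ∫ t in (0 : ℝ)..T, b m * Complex.exp (l m * Complex.I * t))
      (∫ t in (0 : ℝ)..T, ∑' m, b m * Complex.exp (l m * Complex.I * t)) := by
    refine intervalIntegral.hasSum_integral_of_dominated_convergence (fun m _ => ‖b m‖)
      (fun m => Continuous.aestronglyMeasurable (by fun_prop)) (fun m => ?_) ?_ ?_ ?_
    · exact ae_of_all _ fun t _ => by rw [norm_mul, norm_exp_ofReal_mul_I_mul, mul_one]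
    · exact ae_of_all _ fun t _ => hb
    · exact intervalIntegrable_const
    · exact ae_of_all _ fun t _ => (summable_norm_mul_exp hb l t).of_norm.hasSum
  rw [← hI.tsum_eq, ← tsum_mul_left]
  refine tsum_congr fun m => ?_
  rw [intervalIntegral.integral_const_mul]
  ring

/-- Carathéodory's inequality for absolutely convergent trigonometric series with frequencies
`-log m`, `m ≥ 1`, and nonnegative real part. -/
theorem norm_coeff_le_two_mul_re {b : ℕ → ℂ} (hb : Summable fun m => ‖b m‖)
    (hre : ∀ t : ℝ, 0 ≤ (∑' m : ℕ, b m *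
      Complex.exp ((-Real.log (m + 1) : ℝ) * Complex.I * t)).re)
    {n : ℕ} (hn : 1 ≤ n) : ‖b n‖ ≤ 2 * (b 0).re := by
  set F : ℝ → ℂ := fun t => ∑' m : ℕ, b m *
    Complex.exp ((-Real.log (m + 1) : ℝ) * Complex.I * t) with hF
  have hshift : ∀ (μ t : ℝ), F t * Complex.exp (μ * Complex.I * t) = ∑' m : ℕ, b m *
      Complex.exp ((-Real.log (m + 1) + μ : ℝ) * Complex.I * t) := by
    intro μ t
    rw [hF, ← tsum_mul_right]
    refine tsum_congr fun m => ?_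
    rw [mul_assoc, ← Complex.exp_add]
    push_cast
    ring_nf
  have hFc : Continuous F := continuous_trigSeries hb _
  have hmean : ∀ μ : ℝ, Tendsto (fun T : ℝ => (T : ℂ)⁻¹ *
      ∫ t in (0 : ℝ)..T, F t * Complex.exp (μ * Complex.I * t)) atTop
      (𝓝 (∑' m : ℕ, b m * if -Real.log (m + 1) + μ = 0 then 1 else 0)) := by
    intro μ
    simp_rw [hshift μ]
    exact tendsto_mean_trigSeries hb _
  have hlog : ∀ m k : ℕ, -Real.log (m + 1) + Real.log (k + 1) = 0 ↔ m = k := by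
    intro m k
    rw [neg_add_eq_zero, Real.log_injOn_pos.eq_iff (Set.mem_Ioi.2 (by positivity))
      (Set.mem_Ioi.2 (by positivity))]
    exact_mod_cast Nat.add_right_cancel_iff
  have hmeank : ∀ k : ℕ, Tendsto (fun T : ℝ => (T : ℂ)⁻¹ *
      ∫ t in (0 : ℝ)..T, F t * Complex.exp ((Real.log (k + 1) : ℝ) * Complex.I * t)) atTop
      (𝓝 (b k)) := by
    intro k
    have h := hmean (Real.log (k + 1))
    simp_rw [hlog] at h
    simpa using h
  have hlogn : 0 < Real.log (n + 1) := by
    apply Real.log_pos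
    have : (1 : ℝ) ≤ n := by exact_mod_cast hn
    linarith
  -- The frequencies of `F` are all `≤ 0`, so a further negative shift never reaches zero.
  have hmean0 : Tendsto (fun T : ℝ => (T : ℂ)⁻¹ *
      ∫ t in (0 : ℝ)..T, F t * Complex.exp ((-Real.log (n + 1) : ℝ) * Complex.I * t)) atTop
      (𝓝 0) := by
    have h := hmean (-Real.log (n + 1))
    have hne : ∀ m : ℕ, ¬ (-Real.log (m + 1) + -Real.log (n + 1) = 0) := by
      intro m
      have : 0 ≤ Real.log ((m : ℝ) + 1) := Real.log_nonneg (by linarith [m.cast_nonneg (α := ℝ)])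
      linarith
    simpa [hne] using h
  -- Average `F` against the nonnegative kernel `1 + Re (c * e t)`; its conjugate half contributes
  -- nothing in the limit, by `hmean0`.
  have hc : ∀ c : ℂ, ‖c‖ = 1 → 0 ≤ (b 0 + c / 2 * b n).re := by
    intro c hc
    have h := ((hmeank 0).add ((hmeank n).const_mul (c / 2))).add
      (hmean0.const_mul ((starRingEnd ℂ) c / 2))
    rw [mul_zero, add_zero] at h
    refine ge_of_tendsto ((Complex.continuous_re.tendsto _).comp h) ?_
    filter_upwards [eventually_gt_atTop 0] with T hT
    set e : ℝ → ℂ := fun t => Complex.exp ((Real.log (n + 1) : ℝ) * Complex.I * t) with he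
    have he' : ∀ t : ℝ, Complex.exp ((-Real.log (n + 1) : ℝ) * Complex.I * t) =
        (starRingEnd ℂ) (e t) := by
      intro t
      rw [he]
      simp only [← Complex.exp_conj, map_mul, Complex.conj_ofReal, Complex.conj_I]
      push_cast
      ring_nf
    have hec : Continuous e := by fun_prop
    have hsum : (T : ℂ)⁻¹ * (∫ t in (0 : ℝ)..T, F t *
          Complex.exp ((Real.log ((0 : ℕ) + 1) : ℝ) * Complex.I * t)) +
        c / 2 * ((T : ℂ)⁻¹ * ∫ t in (0 : ℝ)..T, F t * e t) +
        (starRingEnd ℂ) c / 2 * ((T : ℂ)⁻¹ *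
          ∫ t in (0 : ℝ)..T, F t * Complex.exp ((-Real.log (n + 1) : ℝ) * Complex.I * t)) =
        ((T⁻¹ : ℝ) : ℂ) * ∫ t in (0 : ℝ)..T,
          F t * (1 + (c * e t + (starRingEnd ℂ) (c * e t)) / 2) := by
      simp_rw [he']
      have h1 : ∫ t in (0 : ℝ)..T, F t * (1 + (c * e t + (starRingEnd ℂ) (c * e t)) / 2) =
          (∫ t in (0 : ℝ)..T, F t) + c / 2 * (∫ t in (0 : ℝ)..T, F t * e t) +
          (starRingEnd ℂ) c / 2 * ∫ t in (0 : ℝ)..T, F t * (starRingEnd ℂ) (e t) := by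
        have hcc : Continuous fun t => (starRingEnd ℂ) (e t) := Complex.continuous_conj.comp hec
        rw [← intervalIntegral.integral_const_mul, ← intervalIntegral.integral_const_mul,
          ← intervalIntegral.integral_add (Continuous.intervalIntegrable (by fun_prop) _ _)
            (Continuous.intervalIntegrable (by fun_prop) _ _),
          ← intervalIntegral.integral_add (Continuous.intervalIntegrable (by fun_prop) _ _)
            (Continuous.intervalIntegrable (by fun_prop) _ _)]
        refine intervalIntegral.integral_congr fun t _ => ?_
        simp only [map_mul]
        ring
      rw [h1]
      simp
      ring
    refine le_of_le_of_eq ?_ (congrArg Complex.re hsum).symm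
    rw [Complex.re_ofReal_mul]
    refine mul_nonneg (by positivity) ?_
    have hcc : Continuous fun t => (starRingEnd ℂ) (c * e t) :=
      Complex.continuous_conj.comp (by fun_prop)
    have hint : IntervalIntegrable
        (fun t => F t * (1 + (c * e t + (starRingEnd ℂ) (c * e t)) / 2)) volume 0 T :=
      Continuous.intervalIntegrable (by fun_prop) _ _
    have hre' : (∫ t in (0 : ℝ)..T, F t * (1 + (c * e t + (starRingEnd ℂ) (c * e t)) / 2)).re =
        ∫ t in (0 : ℝ)..T, (F t * (1 + (c * e t + (starRingEnd ℂ) (c * e t)) / 2)).re :=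
      (Complex.reCLM.intervalIntegral_comp_comm hint).symm
    rw [hre']
    refine intervalIntegral.integral_nonneg hT.le fun t _ => ?_
    have hz : (1 + (c * e t + (starRingEnd ℂ) (c * e t)) / 2) = ((1 + (c * e t).re : ℝ) : ℂ) := by
      rw [Complex.add_conj]
      push_cast
      ring
    rw [hz, Complex.re_mul_ofReal]
    refine mul_nonneg (hre t) ?_
    have h1 : ‖c * e t‖ = 1 := by rw [norm_mul, hc, norm_exp_ofReal_mul_I_mul, one_mul]
    have h2 := (abs_le.1 (Complex.abs_re_le_norm (c * e t))).1
    linarith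
  rcases eq_or_ne (b n) 0 with h0 | h0
  · have h := hc 1 (by simp)
    rw [h0] at h ⊢
    simpa using h
  · have hpos : 0 < ‖b n‖ := norm_pos_iff.2 h0
    -- This phase turns `c * b n` into `-‖b n‖`.
    have h := hc (-(starRingEnd ℂ) (b n) / ‖b n‖) (by simp [hpos.ne'])
    have h1 : b 0 + -(starRingEnd ℂ) (b n) / ‖b n‖ / 2 * b n = b 0 - ((‖b n‖ / 2 : ℝ) : ℂ) := by
      have h2 : (starRingEnd ℂ) (b n) * b n = (‖b n‖ : ℂ) ^ 2 := Complex.conj_mul' _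
      have h3 : (‖b n‖ : ℂ) ≠ 0 := by exact_mod_cast hpos.ne'
      push_cast
      field_simp
      linear_combination (-1 : ℂ) * h2
    rw [h1, Complex.sub_re, Complex.ofReal_re] at h
    linarith

/-! ### Dirichlet series -/

theorem norm_div_natCast_cpow (z : ℂ) {n : ℕ} (hn : 1 ≤ n) (s : ℂ) :
    ‖z / (n : ℂ) ^ s‖ = ‖z‖ / (n : ℝ) ^ s.re := by
  rw [norm_div, Complex.norm_natCast_cpow_of_pos hn]

theorem partialSum_succ (a : ℕ → ℂ) (k : ℕ) (s : ℂ) :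
    partialSum a (k + 1) s = partialSum a k s + a (k + 1) / ((k + 1 : ℕ) : ℂ) ^ s :=
  Finset.sum_Icc_succ_top (by omega) _

theorem partialSum_eq_sum_range (a : ℕ → ℂ) (k : ℕ) (s : ℂ) :
    partialSum a k s = ∑ m ∈ Finset.range k, a (m + 1) / ((m + 1 : ℕ) : ℂ) ^ s := by
  induction k with
  | zero => simp [partialSum]
  | succ k ih => rw [partialSum_succ, ih, Finset.sum_range_succ]

theorem exists_norm_coeff_le {a : ℕ → ℂ} {f : ℂ → ℂ} (ha : IsDirichletSeriesOf a f) :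
    ∃ C : ℝ, ∀ n : ℕ, 1 ≤ n → ‖a n‖ ≤ C * n := by
  have h := ha 1 (by simp [halfPlane])
  have h1 := ((tendsto_add_atTop_iff_nat 1).2 h).sub h
  simp_rw [partialSum_succ, add_sub_cancel_left] at h1
  obtain ⟨C, hC⟩ := h1.norm.bddAbove_range
  refine ⟨C, fun n hn => ?_⟩
  obtain ⟨m, rfl⟩ : ∃ m, n = m + 1 := ⟨n - 1, by omega⟩
  have h2 := hC ⟨m, rfl⟩
  simp only at h2
  rw [norm_div_natCast_cpow _ hn, Complex.one_re, Real.rpow_one] at h2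
  rwa [div_le_iff₀ (by positivity)] at h2

/-- A Dirichlet series convergent in the right half-plane converges absolutely on `Re s = 3`. -/
theorem summable_norm_coeff_div {a : ℕ → ℂ} {f : ℂ → ℂ} (ha : IsDirichletSeriesOf a f) :
    Summable fun m : ℕ => ‖a (m + 1) / ((m + 1 : ℕ) : ℂ) ^ (3 : ℕ)‖ := by
  obtain ⟨C, hC⟩ := exists_norm_coeff_le ha
  have hs : Summable fun m : ℕ => C * (1 / ((m + 1 : ℕ) : ℝ) ^ 2) :=
    ((summable_nat_add_iff 1).2 (Real.summable_one_div_nat_pow.2 one_lt_two)).mul_left C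
  refine hs.of_nonneg_of_le (fun _ => norm_nonneg _) fun m => ?_
  rw [norm_div, norm_pow, Complex.norm_natCast, div_le_iff₀ (by positivity)]
  refine (hC (m + 1) (by omega)).trans_eq ?_
  field_simp

theorem apply_eq_tsum_of_re_eq_three {a : ℕ → ℂ} {f : ℂ → ℂ} (ha : IsDirichletSeriesOf a f) (t : ℝ) :
    f (3 + t * Complex.I) = ∑' m : ℕ, a (m + 1) / ((m + 1 : ℕ) : ℂ) ^ (3 : ℕ) *
      Complex.exp ((-Real.log (m + 1) : ℝ) * Complex.I * t) := by
  have h := ha (3 + t * Complex.I) (by simp [halfPlane])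
  simp_rw [partialSum_eq_sum_range] at h
  refine tendsto_nhds_unique h (Tendsto.congr (fun k => Finset.sum_congr rfl fun m _ => ?_)
    (summable_norm_mul_exp (summable_norm_coeff_div ha) _ t).of_norm.hasSum.tendsto_sum_nat)
  have hm : ((m + 1 : ℕ) : ℂ) ≠ 0 := by exact_mod_cast Nat.succ_ne_zero m
  have hl : ((m + 1 : ℕ) : ℂ) ^ (t * Complex.I) =
      Complex.exp ((Real.log (m + 1) : ℝ) * Complex.I * t) := by
    rw [Complex.cpow_def_of_ne_zero hm, ← Complex.natCast_log]
    push_cast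
    ring_nf
  rw [Complex.cpow_add _ _ hm, hl, show (3 : ℂ) = ((3 : ℕ) : ℂ) by norm_num,
    Complex.cpow_natCast, div_mul_eq_div_div]
  rw [show ((-Real.log (m + 1) : ℝ) : ℂ) * Complex.I * t =
    -((Real.log (m + 1) : ℝ) * Complex.I * t) by push_cast; ring, Complex.exp_neg, div_eq_mul_inv _
    (Complex.exp _)]

/-- Carathéodory-type coefficient inequality for Dirichlet series with nonnegative real part. -/
theorem norm_coeff_le {a : ℕ → ℂ} {f : ℂ → ℂ} (ha : IsDirichletSeriesOf a f)
    (hre : ∀ s ∈ halfPlane 0, 0 ≤ (f s).re) {n : ℕ} (hn : 2 ≤ n) :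
    ‖a n‖ ≤ 2 * (a 1).re * n ^ 3 := by
  obtain ⟨m, rfl⟩ : ∃ m, n = m + 1 := ⟨n - 1, by omega⟩
  have h := norm_coeff_le_two_mul_re (summable_norm_coeff_div ha)
    (fun t => by
      rw [← apply_eq_tsum_of_re_eq_three ha t]
      exact hre _ (by simp [halfPlane])) (n := m) (by omega)
  rw [norm_div, norm_pow, Complex.norm_natCast, div_le_iff₀ (by positivity)] at h
  simpa using h

/-- If `Re a 1` were zero, the coefficient bound would kill all later terms, and `f 1 = a 1` would
have real part zero. -/
theorem re_coeff_one_pos {a : ℕ → ℂ} {f : ℂ → ℂ} (ha : IsDirichletSeriesOf a f)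
    (hre : ∀ s ∈ halfPlane 0, 0 < (f s).re) : 0 < (a 1).re := by
  have hle : ∀ n : ℕ, 2 ≤ n → ‖a n‖ ≤ 2 * (a 1).re * n ^ 3 := fun n hn =>
    norm_coeff_le ha (fun s hs => (hre s hs).le) hn
  have h0 : 0 ≤ (a 1).re := by
    have := (norm_nonneg _).trans (hle 2 le_rfl)
    norm_num at this
    linarith
  refine h0.lt_of_ne fun h => ?_
  have hz : ∀ n : ℕ, 2 ≤ n → a n = 0 := fun n hn => by simpa [← h] using hle n hn
  have hf := ha 1 (by simp [halfPlane])
  have hc : ∀ k : ℕ, partialSum a (k + 1) 1 = a 1 := by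
    intro k
    rw [partialSum_eq_sum_range, Finset.sum_range_succ']
    simp [hz]
  have : f 1 = a 1 := tendsto_nhds_unique ((tendsto_add_atTop_iff_nat 1).2 hf)
    (by simp [hc])
  have h1 := hre 1 (by simp [halfPlane])
  rw [this, ← h] at h1
  exact h1.false

theorem differentiable_partialSum (a : ℕ → ℂ) (k : ℕ) : Differentiable ℂ (partialSum a k) := by
  have h : partialSum a k =
      fun s => ∑ m ∈ Finset.range k, a (m + 1) / ((m + 1 : ℕ) : ℂ) ^ s :=
    funext fun s => partialSum_eq_sum_range a k s
  rw [h]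
  refine Differentiable.fun_sum fun m _ => ?_
  have hm : ((m + 1 : ℕ) : ℂ) ≠ 0 := by exact_mod_cast Nat.succ_ne_zero m
  exact (differentiable_const _).div (differentiable_id.const_cpow (Or.inl hm))
    fun s h => hm ((Complex.cpow_eq_zero_iff _ _).1 h).1

theorem tendsto_partialSum_atTop (a : ℕ → ℂ) (k : ℕ) :
    Tendsto (fun x : ℝ => partialSum a (k + 1) x) atTop (𝓝 (a 1)) := by
  simp_rw [partialSum_eq_sum_range, Finset.sum_range_succ']
  have h : Tendsto (fun x : ℝ => ∑ m ∈ Finset.range k,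
      a (m + 1 + 1) / ((m + 1 + 1 : ℕ) : ℂ) ^ (x : ℂ)) atTop
      (𝓝 (∑ m ∈ Finset.range k, 0)) := by
    refine tendsto_finsetSum _ fun m _ => ?_
    have h1 : Tendsto (fun x : ℝ => ‖a (m + 1 + 1)‖ * ((m + 1 + 1 : ℕ) : ℝ)⁻¹ ^ x) atTop
        (𝓝 (‖a (m + 1 + 1)‖ * 0)) := by
      refine (tendsto_rpow_atTop_of_base_lt_one _ ?_ ?_).const_mul _
      · have : (0 : ℝ) < ((m + 1 + 1 : ℕ) : ℝ)⁻¹ := by positivity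
        linarith
      · apply inv_lt_one_of_one_lt₀
        push_cast
        linarith [m.cast_nonneg (α := ℝ)]
    rw [mul_zero] at h1
    refine squeeze_zero_norm (fun x => ?_) h1
    rw [norm_div_natCast_cpow _ (by omega), Complex.ofReal_re, Real.inv_rpow (by positivity),
      div_eq_mul_inv]
  simpa using h.add_const (a 1)

/-! ### Affine changes of the series -/

/-- The coefficients of the series `u + v f`. -/
def affineCoeff (u v : ℂ) (a : ℕ → ℂ) (n : ℕ) : ℂ := (if n = 1 then u else 0) + v * a n

theorem partialSum_affineCoeff (u v : ℂ) (a : ℕ → ℂ) {k : ℕ} (hk : 1 ≤ k) (s : ℂ) :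
    partialSum (affineCoeff u v a) k s = u + v * partialSum a k s := by
  simp only [partialSum, affineCoeff, add_div, Finset.sum_add_distrib, Finset.mul_sum, mul_div_assoc]
  congr 1
  rw [Finset.sum_eq_single 1]
  · simp
  · intro n _ hn
    simp [hn]
  · intro h
    exact absurd (Finset.mem_Icc.2 ⟨le_rfl, hk⟩) h

theorem IsDirichletSeriesOf.affine {a : ℕ → ℂ} {f : ℂ → ℂ} (ha : IsDirichletSeriesOf a f)
    (u v : ℂ) : IsDirichletSeriesOf (affineCoeff u v a) fun s => u + v * f s := by
  intro s hs
  refine (((ha s hs).const_mul v).const_add u).congr' ?_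
  filter_upwards [eventually_ge_atTop 1] with k hk
  rw [partialSum_affineCoeff u v a hk]

theorem IsHInfty.affine {f : ℂ → ℂ} (hf : IsHInfty f) (u v : ℂ) :
    IsHInfty fun s => u + v * f s := by
  obtain ⟨hd, M, hM⟩ := hf
  refine ⟨(hd.const_mul v).const_add u, ‖u‖ + ‖v‖ * M, fun s hs => ?_⟩
  refine (norm_add_le _ _).trans ?_
  rw [norm_mul]
  gcongr
  exact hM s hs

/-! ### The extremal problem for the closed right half-plane -/

/-- The analogue of `admissible` for the closed right half-plane. -/
def reAdmissible : Set ℝ :=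
  {σ : ℝ | 0 ≤ σ ∧ ∀ (f : ℂ → ℂ) (a : ℕ → ℂ), IsHInfty f → IsDirichletSeriesOf a f →
    (∀ s ∈ halfPlane 0, 0 ≤ (f s).re) →
      ∀ k : ℕ, 1 ≤ k → ∀ s ∈ halfPlane σ, 0 ≤ (partialSum a k s).re}

theorem six_mem_reAdmissible : (6 : ℝ) ∈ reAdmissible := by
  refine ⟨by norm_num, fun f a _ ha hre k hk s hs => ?_⟩
  have hle : ∀ n : ℕ, 2 ≤ n → ‖a n‖ ≤ 2 * (a 1).re * n ^ 3 := fun n hn => norm_coeff_le ha hre hn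
  have h0 : 0 ≤ (a 1).re := by
    have := (norm_nonneg _).trans (hle 2 le_rfl)
    norm_num at this
    linarith
  -- Since `6 = 3 + 3`, the `n`-th term is at most `2 * (a 1).re / n ^ 3`, which is below the
  -- telescoping `(a 1).re * (1 / (n - 1) - 1 / n)`. Hence the strengthened induction claim.
  have key : ∀ m : ℕ, (a 1).re / (m + 1 : ℕ) ≤ (partialSum a (m + 1) s).re := by
    intro m
    induction m with
    | zero => simp [partialSum]
    | succ m ih =>
      rw [partialSum_succ, Complex.add_re]
      have hx : (2 : ℝ) ≤ ((m + 1 + 1 : ℕ) : ℝ) := by exact_mod_cast (by omega : 2 ≤ m + 1 + 1)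
      have hx1 : ((m + 1 : ℕ) : ℝ) = ((m + 1 + 1 : ℕ) : ℝ) - 1 := by push_cast; ring
      rw [hx1] at ih
      have hn := norm_div_natCast_cpow (a (m + 1 + 1)) (n := m + 1 + 1) (by omega) s
      have hb := hle (m + 1 + 1) (by omega)
      have hneg := (abs_le.1 (Complex.abs_re_le_norm
        (a (m + 1 + 1) / ((m + 1 + 1 : ℕ) : ℂ) ^ s))).1
      rw [hn] at hneg
      set x : ℝ := ((m + 1 + 1 : ℕ) : ℝ)
      have hpow : x ^ 6 ≤ x ^ s.re := by
        rw [← Real.rpow_natCast]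
        exact Real.rpow_le_rpow_of_exponent_le (by linarith)
          (by push_cast; exact (show (6 : ℝ) < s.re from hs).le)
      have hq : ‖a (m + 1 + 1)‖ / x ^ s.re ≤ (a 1).re / (x - 1) - (a 1).re / x := by
        calc ‖a (m + 1 + 1)‖ / x ^ s.re ≤ (2 * (a 1).re * x ^ 3) / x ^ 6 := by gcongr
          _ = (a 1).re * (2 / x ^ 3) := by field_simp
          _ ≤ (a 1).re * (1 / (x * (x - 1))) := by
            refine mul_le_mul_of_nonneg_left ?_ h0
            rw [div_le_div_iff₀ (by positivity) (by nlinarith)]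
            nlinarith [mul_nonneg (by linarith : 0 ≤ x) (by linarith : 0 ≤ x - 2),
              mul_nonneg (mul_nonneg (by linarith : 0 ≤ x) (by linarith : 0 ≤ x))
                (by linarith : 0 ≤ x - 2)]
          _ = (a 1).re / (x - 1) - (a 1).re / x := by
            have : x - 1 ≠ 0 := by linarith
            have : x ≠ 0 := by linarith
            field_simp
            ring
      linarith
  obtain ⟨m, rfl⟩ : ∃ m, k = m + 1 := ⟨k - 1, by omega⟩
  exact le_trans (by positivity) (key m)

theorem convex_halfPlane (σ : ℝ) : Convex ℝ (halfPlane σ) :=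
  convex_halfSpace_re_gt σ

theorem isOpen_halfPlane (σ : ℝ) : IsOpen (halfPlane σ) :=
  isOpen_lt continuous_const Complex.continuous_re

/-- The strict form of the defining property of `reAdmissible`. -/
theorem re_partialSum_pos {σ : ℝ} (hσ : σ ∈ reAdmissible) {a : ℕ → ℂ} {f : ℂ → ℂ}
    (hf : IsHInfty f) (ha : IsDirichletSeriesOf a f) (hre : ∀ s ∈ halfPlane 0, 0 < (f s).re)
    {k : ℕ} (hk : 1 ≤ k) {s : ℂ} (hs : s ∈ halfPlane σ) : 0 < (partialSum a k s).re := by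
  have hnn := hσ.2 f a hf ha (fun z hz => (hre z hz).le) k hk
  refine (hnn s hs).lt_of_ne fun h0 => ?_
  have han : AnalyticOnNhd ℂ (partialSum a k) (halfPlane σ) :=
    (differentiable_partialSum a k).differentiableOn.analyticOnNhd (isOpen_halfPlane σ)
  -- By the open mapping theorem, a nonconstant partial sum with a purely imaginary value would also
  -- take values with negative real part. A constant one equals its limit `a 1`.
  rcases han.is_constant_or_isOpen (convex_halfPlane σ).isPreconnected with ⟨w, hw⟩ | hopen
  · obtain ⟨m, rfl⟩ : ∃ m, k = m + 1 := ⟨k - 1, by omega⟩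
    have hlim : Tendsto (fun x : ℝ => partialSum a (m + 1) x) atTop (𝓝 w) := by
      refine tendsto_const_nhds.congr' ?_
      filter_upwards [eventually_gt_atTop σ] with x hx
      exact (hw x (by simpa [halfPlane] using hx)).symm
    have h1 := tendsto_nhds_unique hlim (tendsto_partialSum_atTop a m)
    rw [hw s hs, h1] at h0
    exact (re_coeff_one_pos ha hre).ne h0
  · obtain ⟨ε, hε, hball⟩ := Metric.isOpen_iff.1
      (hopen (halfPlane σ) subset_rfl (isOpen_halfPlane σ)) _ (Set.mem_image_of_mem _ hs)
    have hmem : partialSum a k s - ((ε / 2 : ℝ) : ℂ) ∈ Metric.ball (partialSum a k s) ε := by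
      rw [mem_ball_iff_norm, sub_sub_cancel_left, norm_neg, Complex.norm_real,
        Real.norm_of_nonneg (by positivity)]
      linarith
    obtain ⟨z, hz, hzeq⟩ := hball hmem
    have := hnn z hz
    rw [hzeq, Complex.sub_re, Complex.ofReal_re, ← h0] at this
    linarith

/-! ### Reduction of convex domains to the half-plane -/

theorem exists_separating_multiplier {G : Set ℂ} (hopen : IsOpen G) (hconv : Convex ℝ G)
    {q : ℂ} (hq : q ∉ G) : ∃ v : ℂ, ∀ w ∈ G, (v * w).re < (v * q).re := by
  obtain ⟨L, hL⟩ := geometric_hahn_banach_open_point hconv hopen hq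
  -- Every real-linear functional on `ℂ` is `z ↦ Re (v * z)` for this `v`.
  refine ⟨L 1 - L Complex.I * Complex.I, fun w hw => ?_⟩
  have h : ∀ z : ℂ, (((L 1 : ℂ) - L Complex.I * Complex.I) * z).re = L z := by
    intro z
    have hz : z = z.re • (1 : ℂ) + z.im • Complex.I := by
      simp [Complex.re_add_im]
    conv_rhs => rw [hz, map_add, map_smul, map_smul]
    simp
    ring
  rw [h, h]
  exact hL w hw

/-- A bounded convex domain contains a disk tangent to one of its supporting lines. -/
theorem exists_tangent_ball {G : Set ℂ} (hne : G.Nonempty) (hopen : IsOpen G)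
    (hconv : Convex ℝ G) (hbdd : Bornology.IsBounded G) :
    ∃ (p u : ℂ) (r : ℝ), 0 < r ∧ ‖u‖ = 1 ∧ Metric.ball p r ⊆ G ∧
      ∀ w ∈ G, (u * (w - p)).re < r := by
  obtain ⟨p, hp⟩ := hne
  have hcne : Gᶜ.Nonempty := by
    rw [Set.nonempty_compl]
    rintro rfl
    exact NormedSpace.unbounded_univ ℝ ℂ hbdd
  -- With `q` a point of the complement nearest to `p`, the ball of radius `dist p q` lies in `G`,
  -- and a line separating `q` from `G` is tangent to it.
  obtain ⟨q, hq, hdist⟩ := hopen.isClosed_compl.exists_infDist_eq_dist hcne p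
  obtain ⟨v, hv⟩ := exists_separating_multiplier hopen hconv hq
  have hv0 : v ≠ 0 := by
    rintro rfl
    simpa using hv p hp
  have hvpos : 0 < ‖v‖ := norm_pos_iff.2 hv0
  have hpq : p ≠ q := fun h => hq (h ▸ hp)
  refine ⟨p, v / ‖v‖, dist p q, dist_pos.2 hpq, by simp [hvpos.ne'], ?_, fun w hw => ?_⟩
  · rw [← hdist]
    simpa using Metric.ball_infDist_compl_subset (s := G) (x := p)
  · have h1 : ∀ z : ℂ, (v / ‖v‖ * z).re = (v * z).re / ‖v‖ := fun z => by
      rw [div_mul_eq_mul_div, Complex.div_ofReal_re]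
    have h2 : (v / ‖v‖ * (q - p)).re ≤ dist p q := by
      refine (Complex.re_le_norm _).trans ?_
      rw [norm_mul, dist_comm, dist_eq_norm]
      simp [hvpos.ne']
    refine lt_of_lt_of_le ?_ h2
    rw [h1, h1, mul_sub, mul_sub, Complex.sub_re, Complex.sub_re]
    gcongr
    exact hv w hw

theorem reAdmissible_subset_admissible {G : Set ℂ} (hopen : IsOpen G) (hconv : Convex ℝ G) :
    reAdmissible ⊆ admissible G := by
  refine fun σ hσ => ⟨hσ.1, fun f a hf ha hG k hk s hs => ?_⟩
  by_contra hq
  obtain ⟨v, hv⟩ := exists_separating_multiplier hopen hconv hq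
  have h := re_partialSum_pos hσ (hf.affine (v * partialSum a k s) (-v))
    (ha.affine (v * partialSum a k s) (-v)) (fun z hz => by
      have := hv (f z) (hG hz)
      rw [neg_mul, Complex.add_re, Complex.neg_re]
      linarith) hk hs
  rw [partialSum_affineCoeff _ _ _ hk] at h
  simp at h

theorem admissible_subset_reAdmissible {G : Set ℂ} (hne : G.Nonempty) (hopen : IsOpen G)
    (hconv : Convex ℝ G) (hbdd : Bornology.IsBounded G) : admissible G ⊆ reAdmissible := by
  refine fun σ hσ => ⟨hσ.1, fun f a hf ha hre k hk s hs => ?_⟩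
  obtain ⟨p, u, r, hr, hu, hball, hsupp⟩ := exists_tangent_ball hne hopen hconv hbdd
  obtain ⟨M, hM⟩ := hf.2
  refine le_of_forall_pos_le_add fun ε hε => ?_
  -- `R` is large enough that `‖w‖ ≤ M + ε` and `Re w ≥ ε` force `‖R - w‖ < R`.
  obtain ⟨R, hR0, hR⟩ : ∃ R : ℝ, 0 < R ∧ (M + ε) ^ 2 < 2 * R * ε := by
    refine ⟨((M + ε) ^ 2 + 1) / (2 * ε), by positivity, ?_⟩
    have : 2 * (((M + ε) ^ 2 + 1) / (2 * ε)) * ε = (M + ε) ^ 2 + 1 := by field_simp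
    linarith
  have hu0 : u ≠ 0 := norm_pos_iff.1 (by rw [hu]; exact one_pos)
  have hRc : (R : ℂ) ≠ 0 := by exact_mod_cast hR0.ne'
  -- The map `w ↦ p + r / (u * R) * (R - w)`, applied to `w = f z + ε`, sends the disk `‖R - w‖ < R`
  -- onto `ball p r` and `0` to the tangency point.
  have hmaps : Set.MapsTo (fun z => (p + r / (u * R) * (R - ε)) + -(r / (u * R)) * f z)
      (halfPlane 0) G := by
    intro z hz
    apply hball
    rw [mem_ball_iff_norm]
    have h1 : (p + r / (u * R) * (R - ε)) + -(r / (u * R)) * f z - p =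
        r / (u * R) * (R - (f z + ε)) := by ring
    simp only [h1]
    have h2 : ‖(R : ℂ) - (f z + ε)‖ < R := by
      have hn : ‖f z + ε‖ ≤ M + ε := by
        refine (norm_add_le _ _).trans ?_
        rw [Complex.norm_real, Real.norm_of_nonneg hε.le]
        linarith [hM z hz]
      have hn2 : ‖f z + ε‖ ^ 2 ≤ (M + ε) ^ 2 := by gcongr
      have hsq : ‖(R : ℂ) - (f z + ε)‖ ^ 2 = R ^ 2 - 2 * R * ((f z).re + ε) + ‖f z + ε‖ ^ 2 := by
        simp only [Complex.sq_norm, Complex.normSq_apply]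
        simp
        ring
      refine lt_of_pow_lt_pow_left₀ 2 hR0.le ?_
      rw [hsq]
      nlinarith [mul_nonneg hR0.le (hre z hz)]
    rw [norm_mul, norm_div, norm_mul, hu, one_mul, Complex.norm_real, Complex.norm_real,
      Real.norm_of_nonneg hr.le, Real.norm_of_nonneg hR0.le]
    calc r / R * ‖(R : ℂ) - (f z + ε)‖ < r / R * R := by gcongr
      _ = r := by field_simp
  have h := hsupp _ (hσ.2 _ _ (hf.affine _ _) (ha.affine _ _) hmaps k hk hs)
  rw [partialSum_affineCoeff _ _ _ hk] at h
  have h3 : u * (p + r / (u * R) * (R - ε) + -(r / (u * R)) * partialSum a k s - p) =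
      ((r - r / R * ε : ℝ) : ℂ) - ((r / R : ℝ) : ℂ) * partialSum a k s := by
    push_cast
    field_simp
    ring
  rw [h3, Complex.sub_re, Complex.ofReal_re, Complex.re_ofReal_mul] at h
  have h4 : 0 < r / R * ((partialSum a k s).re + ε) := by linarith
  exact (pos_of_mul_pos_right h4 (by positivity)).le

theorem admissible_eq_reAdmissible {G : Set ℂ} (hne : G.Nonempty) (hopen : IsOpen G)
    (hconv : Convex ℝ G) (hbdd : Bornology.IsBounded G) : admissible G = reAdmissible :=
  (admissible_subset_reAdmissible hne hopen hconv hbdd).antisymm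
    (reAdmissible_subset_admissible hopen hconv)

end Rogosinski

theorem theorem2p4 (G : Set ℂ) (hne : G.Nonempty) (hopen : IsOpen G) (hconv : Convex ℝ G)
    (hbdd : Bornology.IsBounded G) :
    (Rogosinski.admissible G).Nonempty ∧
      (Rogosinski.admissible (Metric.ball (0 : ℂ) 1)).Nonempty ∧
      Rogosinski.abscissa G = Rogosinski.abscissa (Metric.ball (0 : ℂ) 1) := by
  have hG := Rogosinski.admissible_eq_reAdmissible hne hopen hconv hbdd
  have hU := Rogosinski.admissible_eq_reAdmissible (Metric.nonempty_ball.2 one_pos)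
    Metric.isOpen_ball (convex_ball (0 : ℂ) 1) Metric.isBounded_ball
  have h6 : Rogosinski.reAdmissible.Nonempty := ⟨6, Rogosinski.six_mem_reAdmissible⟩
  refine ⟨hG ▸ h6, hU ▸ h6, ?_⟩
  rw [Rogosinski.abscissa, Rogosinski.abscissa, hG, hU]
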